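/- On $M=\mathbb R^3$ with coordinates $(x,y,z)$ (the Heisenberg group) consider the vector fields $X_1=\partial_x-\frac y2\partial_z$, $X_2=\partial_y+\frac x2\partial_z$, and the sub-Lorentzian structure on the distribution $\Delta=\mathrm{span}(X_1,X_2)$ given by the metric $g$ with $g(X_1,X_1)=-1$, $g(X_2,X_2)=1$, $g(X_1,X_2)=0$, with time orientation $X_1$. A future directed nonspacelike (respectively timelike) curve is a Lipschitz curve $\gamma:[0,T]\to M$ with $\dot\gamma(t)=u_1(t)X_1(\gamma(t))+u_2(t)X_2(\gamma(t))$ and $u_1(t)\ge|u_2(t)|$ (respectively $u_1(t)>|u_2(t)|$) for almost every $t$; its length is $l(\gamma)=\int_0^T|g(\dot\gamma,\dot\gamma)|^{1/2}\,dt=\int_0^T\sqrt{u_1^2-u_2^2}\,dt$. Let $q_0=(0,0,0)$. The causal future $J^+(q_0)$ is the set of end points of future directed nonspacelike curves starting at $q_0$ with $T\ge 0$, the chronological future $I^+(q_0)$ is the set of end points of future directed timelike curves starting at $q_0$ with $T>0$, and for $q\in J^+(q_0)$ $$d(q)=\sup\{\,l(\gamma)\;:\;\gamma\text{ a future directed nonspacelike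 curve from }q_0\text{ to }q\,\}.$$ The function $\alpha(p)=\dfrac{\sinh 2p-2p}{8\sinh^2p}$, with $\alpha(0)=0$, is a bijection from $\mathbb R$ onto $(-\frac14,\frac14)$; let $\beta$ be its inverse, extended by $\beta(\pm\frac14)=\pm\infty$. Read $\dfrac p{\sinh p}$ as $1$ at $p=0$ and as $0$ at $p=\pm\infty$. **Theorem.** Let $q=(x,y,z)\in J^+(q_0)$. Then $4|z|\le x^2-y^2$, the supremum $d(q)$ is finite, and $$d(q)=\sqrt{x^2-y^2}\cdot\frac p{\sinh p},\qquad p=\beta\!\left(\frac z{x^2-y^2}\right),$$ where the right-hand side is read as $0$ if $x^2=y^2$. In particular, for $q=(x,y,z)\in J^+(q_0)$: 1. $z=0\iff d(q)=\sqrt{x^2-y^2}$; 2. $q\in J^+(q_0)\setminus I^+(q_0)\iff d(q)=0$. -/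

import Mathlib

open Set MeasureTheory

namespace HeisSL

noncomputable section

/-- The underlying manifold `ℝ³` of the Heisenberg group, with coordinates `(x, y, z)`. -/
abbrev Heis : Type := ℝ × ℝ × ℝ

/-- The left-invariant field `X₁ = ∂/∂x - (y/2) ∂/∂z`. -/
def X₁ (q : Heis) : Heis := (1, 0, -(q.2.1 / 2))

/-- The left-invariant field `X₂ = ∂/∂y + (x/2) ∂/∂z`. -/
def X₂ (q : Heis) : Heis := (0, 1, q.1 / 2)

/-- The distribution `Δ_q = span (X₁ q, X₂ q)`. -/
def horizontal (q : Heis) : Submodule ℝ Heis := Submodule.span ℝ {X₁ q, X₂ q}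

/-- The Lorentzian metric. On a horizontal vector `u₁ X₁ + u₂ X₂` the first two coordinates are
`u₁` and `u₂`, so on `Δ_q` this is the form for which `(X₁, X₂)` is an orthonormal frame
(see `g_X₁_X₁`, `g_X₂_X₂`, `g_X₁_X₂`). -/
def g (v w : Heis) : ℝ := -(v.1 * w.1) + v.2.1 * w.2.1

theorem g_X₁_X₁ (q : Heis) : g (X₁ q) (X₁ q) = -1 := by simp [g, X₁]

theorem g_X₂_X₂ (q : Heis) : g (X₂ q) (X₂ q) = 1 := by simp [g, X₂]

theorem g_X₁_X₂ (q : Heis) : g (X₁ q) (X₂ q) = 0 := by simp [g, X₁, X₂]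

/-- Admissible velocities: horizontal, nonspacelike, and in the closed future half given by the
time orientation `X₁`; see `futureNonspacelike_iff`. -/
def FutureNonspacelike (q v : Heis) : Prop :=
  v ∈ horizontal q ∧ g v v ≤ 0 ∧ g v (X₁ q) ≤ 0

/-- Future directed timelike velocities; see `futureTimelike_iff`. -/
def FutureTimelike (q v : Heis) : Prop :=
  v ∈ horizontal q ∧ g v v < 0 ∧ g v (X₁ q) < 0

theorem futureNonspacelike_iff (q v : Heis) :
    FutureNonspacelike q v ↔ ∃ u₁ u₂ : ℝ, |u₂| ≤ u₁ ∧ v = u₁ • X₁ q + u₂ • X₂ q := by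
  unfold FutureNonspacelike horizontal
  rw [Submodule.mem_span_pair]
  constructor
  · rintro ⟨⟨a, b, rfl⟩, h1, h2⟩
    simp only [g, X₁, X₂, Prod.fst_add, Prod.snd_add, Prod.smul_fst, Prod.smul_snd,
      smul_eq_mul] at h1 h2
    exact ⟨a, b, abs_le_of_sq_le_sq (by nlinarith) (by linarith), rfl⟩
  · rintro ⟨a, b, h, rfl⟩
    have h0 : 0 ≤ a := (abs_nonneg b).trans h
    have h1 : b ^ 2 ≤ a ^ 2 := sq_le_sq' (by linarith [neg_abs_le b]) ((le_abs_self b).trans h)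
    refine ⟨⟨a, b, rfl⟩, ?_, ?_⟩ <;>
    simp only [g, X₁, X₂, Prod.fst_add, Prod.snd_add, Prod.smul_fst, Prod.smul_snd,
      smul_eq_mul] <;> nlinarith

theorem futureTimelike_iff (q v : Heis) :
    FutureTimelike q v ↔ ∃ u₁ u₂ : ℝ, |u₂| < u₁ ∧ v = u₁ • X₁ q + u₂ • X₂ q := by
  unfold FutureTimelike horizontal
  rw [Submodule.mem_span_pair]
  constructor
  · rintro ⟨⟨a, b, rfl⟩, h1, h2⟩
    simp only [g, X₁, X₂, Prod.fst_add, Prod.snd_add, Prod.smul_fst, Prod.smul_snd,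
      smul_eq_mul] at h1 h2
    exact ⟨a, b, abs_lt_of_sq_lt_sq (by nlinarith) (by linarith), rfl⟩
  · rintro ⟨a, b, h, rfl⟩
    have h0 : 0 < a := (abs_nonneg b).trans_lt h
    have h1 : b ^ 2 < a ^ 2 := sq_lt_sq' (by linarith [neg_abs_le b]) ((le_abs_self b).trans_lt h)
    refine ⟨⟨a, b, rfl⟩, ?_, ?_⟩ <;>
    simp only [g, X₁, X₂, Prod.fst_add, Prod.snd_add, Prod.smul_fst, Prod.smul_snd,
      smul_eq_mul] <;> nlinarith

/-- `γ`, restricted to `[0, T]`, is a Lipschitz curve from `a` to `b` whose velocity lies in the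
cone field `K` at almost every time (the values of `γ` outside `[0, T]` play no role). -/
structure IsCurve (K : Heis → Heis → Prop) (T : ℝ) (γ : ℝ → Heis) (a b : Heis) : Prop where
  lipschitz : ∃ L, LipschitzOnWith L γ (Icc 0 T)
  velocity : ∀ᵐ t ∂(volume.restrict (Icc 0 T)), DifferentiableAt ℝ γ t ∧ K (γ t) (deriv γ t)
  source : γ 0 = a
  target : γ T = b

/-- The causal future `J⁺(a)`. -/
def causalFuture (a : Heis) : Set Heis :=
  {b | ∃ T : ℝ, 0 ≤ T ∧ ∃ γ : ℝ → Heis, IsCurve FutureNonspacelike T γ a b}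

/-- The chronological future `I⁺(a)`. -/
def chronologicalFuture (a : Heis) : Set Heis :=
  {b | ∃ T : ℝ, 0 < T ∧ ∃ γ : ℝ → Heis, IsCurve FutureTimelike T γ a b}

/-- The length `∫₀ᵀ |g(γ', γ')|^{1/2} dt`. -/
def length (T : ℝ) (γ : ℝ → Heis) : ℝ :=
  ∫ t in (0 : ℝ)..T, Real.sqrt |g (deriv γ t) (deriv γ t)|

/-- The sub-Lorentzian distance `d(a, b)`, the supremum of the lengths of the future directed
nonspacelike curves from `a` to `b`, taken in the extended reals
(it is `⊥` when there is no such curve). -/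
def slDist (a b : Heis) : EReal :=
  sSup {r : EReal | ∃ T : ℝ, 0 ≤ T ∧ ∃ γ : ℝ → Heis,
    IsCurve FutureNonspacelike T γ a b ∧ r = (length T γ : EReal)}

/-- `α(p) = (sinh 2p - 2p) / (8 sinh² p)`; the value at the removable singularity `p = 0` is the
limit `0`, which is also the value of `0 / 0` here. -/
def alpha (p : ℝ) : ℝ := (Real.sinh (2 * p) - 2 * p) / (8 * Real.sinh p ^ 2)

/-- The inverse function `β` of `α`. -/
def beta : ℝ → ℝ := Function.invFun alpha

/-- `β` on the closed interval `[-1/4, 1/4]`, with values `±∞` at the end points. -/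
def betaExt (s : ℝ) : EReal :=
  if 1 / 4 ≤ s then ⊤ else if s ≤ -(1 / 4) then ⊥ else (beta s : EReal)

/-- The function `p / sinh p`, extended by continuity to `p = 0` and `p = ±∞`. -/
def divSinh (p : EReal) : ℝ :=
  if p = ⊤ ∨ p = ⊥ then 0 else if p = 0 then 1 else p.toReal / Real.sinh p.toReal

end

end HeisSL

/-!
In the null coordinates `A = x + y`, `B = x - y` a causal curve has velocity
`A' = u ≥ 0`, `B' = v ≥ 0`, `4 z' = B u - A v`, its length is `∫ √(u v)`, and `x² - y² = A B`.
Since `(A B ± 4 z)' ≥ 0`, every point of the causal future satisfies `4 |z| ≤ x² - y²`.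

The upper bound for the length is a calibration. For every positive function `r` along the curve,
`√(u v) ≤ (r u + v / r) / 2`. For `r = α - β B` the right-hand side is an exact derivative:
`B u = (A B / 2 + 2 z)'` integrates the first term, and `v / r` is the derivative of
`-(log r) / β`. So the length is bounded by a function of the end point alone
(`IsCurve.length_le_of_affine`), and no smoothness of the distance function is needed. The constants
`α`, `β` that make the inequality sharp along the extremal of parameter `p` over `(x, y)` give
`length ≤ √D / 2 * (cosh p - 4 (z / D) sinh p + p / sinh p)` with `D = x² - y²`, for every
`p ≠ 0` (`IsCurve.length_le_of_ne_zero`). If `alpha p = z / D`, this is `√D * p / sinh p`; on the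
boundary `4 |z| = D` it tends to `0` as `p → ±∞`. Constant `r` covers `p = 0` and `D = 0`.

In the interior the bound is attained by an explicit timelike curve, a branch of hyperbola in the
`(x, y)`-plane (`exists_isCurve_alpha`). Hence interior points lie in the chronological future.
Conversely a timelike curve has positive length (`IsCurve.length_pos`), so points at distance `0`
do not.

That `alpha` is a bijection onto `(-1/4, 1/4)` follows from its oddness, the sign of its derivative
on `(0, ∞)`, and the bounds `1 - 1 / p ≤ 4 * alpha p < tanh p` there.
-/

namespace HeisSL

/-! ### The function `alpha` -/

theorem alpha_zero : alpha 0 = 0 := by simp [alpha]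

theorem alpha_neg (p : ℝ) : alpha (-p) = -alpha p := by
  simp only [alpha, mul_neg, Real.sinh_neg]
  ring

theorem sinh_lt_mul_cosh {p : ℝ} (hp : 0 < p) : Real.sinh p < p * Real.cosh p := by
  obtain ⟨c, hc, h⟩ := exists_hasDerivAt_eq_slope Real.sinh Real.cosh hp
    Real.continuous_sinh.continuousOn fun x _ ↦ Real.hasDerivAt_sinh x
  have hlt : Real.cosh c < Real.cosh p := by
    rw [Real.cosh_lt_cosh, abs_of_pos hc.1, abs_of_pos hp]
    exact hc.2
  rw [Real.sinh_zero, sub_zero, sub_zero, eq_div_iff hp.ne'] at h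
  nlinarith

theorem alpha_pos {p : ℝ} (hp : 0 < p) : 0 < alpha p := by
  have h1 : 2 * p < Real.sinh (2 * p) := Real.self_lt_sinh_iff.2 (by linarith)
  have h2 : 0 < Real.sinh p := Real.sinh_pos_iff.2 hp
  exact div_pos (by linarith) (by positivity)

/-- The estimate behind the continuity of `alpha` at `0`. -/
theorem alpha_lt_tanh {p : ℝ} (hp : 0 < p) :
    4 * alpha p < Real.sinh p / Real.cosh p := by
  have hs : 0 < Real.sinh p := Real.sinh_pos_iff.2 hp
  have hc : 0 < Real.cosh p := Real.cosh_pos p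
  have h := sinh_lt_mul_cosh hp
  have hcs := Real.cosh_sq p
  rw [alpha, Real.sinh_two_mul, mul_div_assoc', div_lt_div_iff₀ (by positivity) hc]
  nlinarith

theorem alpha_lt_quarter {p : ℝ} (hp : 0 < p) : alpha p < 1 / 4 := by
  have h := alpha_lt_tanh hp
  have h1 : Real.sinh p / Real.cosh p < 1 :=
    (div_lt_one (Real.cosh_pos p)).2 (Real.sinh_lt_cosh p)
  linarith

/-- The estimate behind the limit of `alpha` at infinity. -/
theorem one_sub_inv_le_alpha {p : ℝ} (hp : 0 < p) : 1 - 1 / p ≤ 4 * alpha p := by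
  have hs : p < Real.sinh p := Real.self_lt_sinh_iff.2 hp
  have hs0 : 0 < Real.sinh p := hp.trans hs
  have hc : Real.sinh p < Real.cosh p := Real.sinh_lt_cosh p
  have h1 : 4 * alpha p = Real.cosh p / Real.sinh p - p / Real.sinh p ^ 2 := by
    rw [alpha, Real.sinh_two_mul]
    field_simp
    ring
  have h2 : 1 ≤ Real.cosh p / Real.sinh p := (one_le_div hs0).2 hc.le
  have h3 : p / Real.sinh p ^ 2 ≤ 1 / p := by
    rw [div_le_div_iff₀ (by positivity) hp]
    nlinarith
  linarith

theorem hasDerivAt_alpha {p : ℝ} (hp : 0 < p) :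
    HasDerivAt alpha ((p * Real.cosh p - Real.sinh p) / (2 * Real.sinh p ^ 3)) p := by
  have hs0 : Real.sinh p ≠ 0 := (Real.sinh_pos_iff.2 hp).ne'
  have h2 : HasDerivAt (fun p : ℝ ↦ 2 * p) 2 p := by simpa using (hasDerivAt_id p).const_mul 2
  have hn := h2.sinh.sub h2
  have hd := ((Real.hasDerivAt_sinh p).pow 2).const_mul 8
  refine (hn.div hd (by simpa using hs0)).congr_deriv ?_
  simp only [Pi.sub_apply, Pi.pow_apply]
  rw [Real.sinh_two_mul, Real.cosh_two_mul, Real.cosh_sq]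
  field_simp
  ring_nf
  simp only [Real.cosh_sq]
  ring

theorem strictMonoOn_alpha : StrictMonoOn alpha (Ioi 0) := by
  refine strictMonoOn_of_deriv_pos (convex_Ioi 0)
    (fun p hp ↦ (hasDerivAt_alpha hp).continuousAt.continuousWithinAt) fun p hp ↦ ?_
  rw [interior_Ioi] at hp
  have hp' : 0 < p := hp
  have hs : 0 < Real.sinh p := Real.sinh_pos_iff.2 hp'
  rw [(hasDerivAt_alpha hp').deriv]
  exact div_pos (sub_pos.2 (sinh_lt_mul_cosh hp')) (by positivity)

theorem exists_alpha_eq_of_pos {s : ℝ} (h0 : 0 < s) (h1 : s < 1 / 4) : ∃ p, alpha p = s := by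
  have hq : 0 < 1 / (1 - 4 * s) := div_pos one_pos (by linarith)
  have hp : 0 < 4 * s := by linarith
  have hlow : alpha (4 * s) ≤ s := by
    have h2 := alpha_lt_tanh hp
    have h3 : Real.sinh (4 * s) / Real.cosh (4 * s) < 4 * s :=
      (div_lt_iff₀ (Real.cosh_pos _)).2 (sinh_lt_mul_cosh hp)
    linarith
  have hhigh : s ≤ alpha (1 / (1 - 4 * s)) := by
    have h2 := one_sub_inv_le_alpha hq
    rw [one_div_one_div] at h2
    linarith
  have hsub : uIcc (4 * s) (1 / (1 - 4 * s)) ⊆ Ioi 0 := fun t ht ↦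
    (lt_inf_iff.2 ⟨hp, hq⟩ : (0 : ℝ) < _).trans_le ht.1
  obtain ⟨p, -, h⟩ := intermediate_value_uIcc
    (fun p hp ↦ (hasDerivAt_alpha (hsub hp)).continuousAt.continuousWithinAt)
    (Icc_subset_uIcc ⟨hlow, hhigh⟩)
  exact ⟨p, h⟩

theorem alpha_injective : Function.Injective alpha := by
  have hpos : ∀ p, 0 < alpha p ↔ 0 < p := fun p ↦ by
    refine ⟨fun h ↦ ?_, alpha_pos⟩
    by_contra! hp
    rcases hp.eq_or_lt with rfl | hp
    · exact h.ne' alpha_zero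
    · linarith [alpha_pos (neg_pos.2 hp), alpha_neg p]
  have key : ∀ p q, alpha p = alpha q → 0 < p → p = q := fun p q h hp ↦
    strictMonoOn_alpha.injOn hp ((hpos q).1 (h ▸ alpha_pos hp)) h
  intro p q h
  rcases lt_trichotomy p 0 with hp | rfl | hp
  · exact neg_injective (key (-p) (-q) (by rw [alpha_neg, alpha_neg, h]) (by linarith))
  · rcases lt_trichotomy q 0 with hq | rfl | hq
    · exact neg_injective (key (-q) (-0) (by rw [alpha_neg, alpha_neg, h]) (by linarith)).symm
    · rfl
    · exact (key q 0 h.symm hq).symm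
  · exact key p q h hp

theorem bijOn_alpha : BijOn alpha univ (Ioo (-(1 / 4)) (1 / 4)) := by
  refine ⟨fun p _ ↦ ?_, alpha_injective.injOn, fun s hs ↦ ?_⟩
  · rcases lt_trichotomy p 0 with hp | rfl | hp
    · have h1 := alpha_pos (neg_pos.2 hp)
      have h2 := alpha_lt_quarter (neg_pos.2 hp)
      rw [alpha_neg] at h1 h2
      exact ⟨by linarith, by linarith⟩
    · rw [alpha_zero]
      norm_num
    · exact ⟨by linarith [alpha_pos hp], alpha_lt_quarter hp⟩
  · simp only [image_univ, mem_range]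
    rcases lt_trichotomy s 0 with h | rfl | h
    · obtain ⟨p, hp⟩ := exists_alpha_eq_of_pos (neg_pos.2 h) (by linarith [hs.1])
      exact ⟨-p, by rw [alpha_neg, hp, neg_neg]⟩
    · exact ⟨0, alpha_zero⟩
    · exact exists_alpha_eq_of_pos h hs.2

theorem alpha_beta {s : ℝ} (hs : s ∈ Ioo (-(1 / 4) : ℝ) (1 / 4)) : alpha (beta s) = s := by
  obtain ⟨p, -, hp⟩ := bijOn_alpha.surjOn hs
  exact Function.invFun_eq ⟨p, hp⟩

/-! ### Null coordinates along a causal curve -/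

/-- In the null coordinates `x + y` and `x - y`, whose derivatives are `u` and `v`, the cone
condition says `0 ≤ u` and `0 ≤ v`, and `-g` of the velocity is the product `u * v`. -/
theorem FutureNonspacelike.exists_null {γ : ℝ → Heis} {t : ℝ} (hd : DifferentiableAt ℝ γ t)
    (h : FutureNonspacelike (γ t) (deriv γ t)) :
    ∃ u v : ℝ, 0 ≤ u ∧ 0 ≤ v ∧ HasDerivAt (fun s ↦ (γ s).1 + (γ s).2.1) u t ∧
      HasDerivAt (fun s ↦ (γ s).1 - (γ s).2.1) v t ∧
      HasDerivAt (fun s ↦ (γ s).2.2)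
        ((((γ t).1 - (γ t).2.1) * u - ((γ t).1 + (γ t).2.1) * v) / 4) t ∧
      g (deriv γ t) (deriv γ t) = -(u * v) := by
  obtain ⟨u₁, u₂, hu, hv⟩ := (futureNonspacelike_iff _ _).1 h
  have h1 : HasDerivAt (fun s ↦ (γ s).1) (deriv γ t).1 t := hd.hasDerivAt.fst
  have h2 : HasDerivAt (fun s ↦ (γ s).2.1) (deriv γ t).2.1 t := hd.hasDerivAt.snd.fst
  have h3 : HasDerivAt (fun s ↦ (γ s).2.2) (deriv γ t).2.2 t := hd.hasDerivAt.snd.snd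
  have := abs_le.1 hu
  refine ⟨u₁ + u₂, u₁ - u₂, by linarith, by linarith, (h1.add h2).congr_deriv ?_,
    (h1.sub h2).congr_deriv ?_, h3.congr_deriv ?_, ?_⟩ <;> rw [hv] <;> simp [g, X₁, X₂] <;> ring

theorem FutureTimelike.futureNonspacelike {q v : Heis} (h : FutureTimelike q v) :
    FutureNonspacelike q v :=
  ⟨h.1, h.2.1.le, h.2.2.le⟩

theorem IsCurve.of_timelike {T : ℝ} {γ : ℝ → Heis} {a b : Heis}
    (h : IsCurve FutureTimelike T γ a b) : IsCurve FutureNonspacelike T γ a b :=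
  ⟨h.lipschitz, h.velocity.mono fun _ ht ↦ ⟨ht.1, ht.2.futureNonspacelike⟩, h.source, h.target⟩

section AbsolutelyContinuous

variable {K : Heis → Heis → Prop} {T : ℝ} {γ : ℝ → Heis} {a b : Heis}

theorem IsCurve.exists_lipschitz_comp (h : IsCurve K T γ a b) {φ : Heis → ℝ} {C : NNReal}
    (hφ : LipschitzWith C φ) : ∃ L, LipschitzOnWith L (fun t ↦ φ (γ t)) (Icc 0 T) := by
  obtain ⟨L, hL⟩ := h.lipschitz
  exact ⟨C * L, hφ.comp_lipschitzOnWith hL⟩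

theorem IsCurve.exists_lipschitz_add (h : IsCurve K T γ a b) :
    ∃ L, LipschitzOnWith L (fun t ↦ (γ t).1 + (γ t).2.1) (Icc 0 T) :=
  h.exists_lipschitz_comp (φ := fun q ↦ q.1 + q.2.1)
    (LipschitzWith.prod_fst.add (LipschitzWith.prod_fst.comp LipschitzWith.prod_snd))

theorem IsCurve.exists_lipschitz_sub (h : IsCurve K T γ a b) :
    ∃ L, LipschitzOnWith L (fun t ↦ (γ t).1 - (γ t).2.1) (Icc 0 T) :=
  h.exists_lipschitz_comp (φ := fun q ↦ q.1 - q.2.1)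
    (LipschitzWith.prod_fst.sub (LipschitzWith.prod_fst.comp LipschitzWith.prod_snd))

theorem IsCurve.exists_lipschitz_snd_snd (h : IsCurve K T γ a b) :
    ∃ L, LipschitzOnWith L (fun t ↦ (γ t).2.2) (Icc 0 T) :=
  h.exists_lipschitz_comp (φ := fun q ↦ q.2.2)
    (LipschitzWith.prod_snd.comp LipschitzWith.prod_snd)

theorem absolutelyContinuous_of_exists_lipschitz {f : ℝ → ℝ} (hT : 0 ≤ T)
    (h : ∃ L, LipschitzOnWith L f (Icc 0 T)) : AbsolutelyContinuousOnInterval f 0 T := by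
  obtain ⟨L, hL⟩ := h
  rw [← uIcc_of_le hT] at hL
  exact hL.absolutelyContinuousOnInterval

/-- Integration of a differential inequality for an absolutely continuous function. The function
`f` need not be integrable: the integral of a function that is not integrable is `0`. -/
theorem integral_le_sub_of_ae_hasDerivAt {F f : ℝ → ℝ} {c d : ℝ} (hcd : c ≤ d)
    (hF : AbsolutelyContinuousOnInterval F c d)
    (h : ∀ᵐ t ∂(volume.restrict (Icc c d)), 0 ≤ f t ∧ ∃ F', HasDerivAt F F' t ∧ f t ≤ F') :
    ∫ t in c..d, f t ≤ F d - F c := by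
  rw [← hF.integral_deriv_eq_sub, intervalIntegral.integral_of_le hcd,
    intervalIntegral.integral_of_le hcd]
  replace h := ae_restrict_of_ae_restrict_of_subset Ioc_subset_Icc_self h
  refine integral_mono_of_nonneg (h.mono fun t ht ↦ ht.1) ?_ (h.mono fun t ht ↦ ?_)
  · exact (intervalIntegrable_iff_integrableOn_Ioc_of_le hcd).1 hF.intervalIntegrable_deriv
  · obtain ⟨-, F', hF', hle⟩ := ht
    simpa only [hF'.deriv] using hle

theorem le_of_ae_hasDerivAt_nonneg {F : ℝ → ℝ} {c d : ℝ} (hcd : c ≤ d)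
    (hF : AbsolutelyContinuousOnInterval F c d)
    (h : ∀ᵐ t ∂(volume.restrict (Icc c d)), ∃ F', HasDerivAt F F' t ∧ 0 ≤ F') :
    F c ≤ F d := by
  have := integral_le_sub_of_ae_hasDerivAt (f := fun _ ↦ 0) hcd hF
    (h.mono fun t ht ↦ ⟨le_rfl, ht⟩)
  simpa using this

theorem IsCurve.ae_exists_null (h : IsCurve FutureNonspacelike T γ a b) :
    ∀ᵐ t ∂(volume.restrict (Icc 0 T)), t ∈ Icc 0 T ∧
      ∃ u v : ℝ, 0 ≤ u ∧ 0 ≤ v ∧ HasDerivAt (fun s ↦ (γ s).1 + (γ s).2.1) u t ∧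
      HasDerivAt (fun s ↦ (γ s).1 - (γ s).2.1) v t ∧
      HasDerivAt (fun s ↦ (γ s).2.2)
        ((((γ t).1 - (γ t).2.1) * u - ((γ t).1 + (γ t).2.1) * v) / 4) t ∧
      g (deriv γ t) (deriv γ t) = -(u * v) := by
  filter_upwards [h.velocity, ae_restrict_mem measurableSet_Icc] with t ht hmem
  exact ⟨hmem, ht.2.exists_null ht.1⟩

/-- The null coordinates are nondecreasing along causal curves. -/
theorem IsCurve.null_coords_le (h : IsCurve FutureNonspacelike T γ a b) {t s : ℝ}
    (ht : 0 ≤ t) (hts : t ≤ s) (hs : s ≤ T) :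
    (γ t).1 + (γ t).2.1 ≤ (γ s).1 + (γ s).2.1 ∧ (γ t).1 - (γ t).2.1 ≤ (γ s).1 - (γ s).2.1 := by
  have hT : 0 ≤ T := ht.trans (hts.trans hs)
  have hsub : Icc t s ⊆ Icc 0 T := Icc_subset_Icc ht hs
  have hae := ae_restrict_of_ae_restrict_of_subset hsub h.ae_exists_null
  have hac {f : ℝ → ℝ} (hf : ∃ L, LipschitzOnWith L f (Icc 0 T)) :
      AbsolutelyContinuousOnInterval f t s :=
    (absolutelyContinuous_of_exists_lipschitz hT hf).mono (by
      rwa [uIcc_of_le hT, uIcc_of_le hts])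
  refine ⟨le_of_ae_hasDerivAt_nonneg hts (hac h.exists_lipschitz_add) (hae.mono ?_),
    le_of_ae_hasDerivAt_nonneg hts (hac h.exists_lipschitz_sub) (hae.mono ?_)⟩
  · rintro r ⟨-, u, v, hu, hv, hA, hB, hZ, hg⟩
    exact ⟨u, hA, hu⟩
  · rintro r ⟨-, u, v, hu, hv, hA, hB, hZ, hg⟩
    exact ⟨v, hB, hv⟩

end AbsolutelyContinuous

/-! ### Upper bounds for the length -/

section Upper

variable {T x y z : ℝ} {γ : ℝ → Heis}

theorem IsCurve.null_coords_mem (h : IsCurve FutureNonspacelike T γ (0, 0, 0) (x, y, z)) {t : ℝ}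
    (ht : t ∈ Icc 0 T) :
    (γ t).1 + (γ t).2.1 ∈ Icc 0 (x + y) ∧ (γ t).1 - (γ t).2.1 ∈ Icc 0 (x - y) := by
  have h1 := h.null_coords_le le_rfl ht.1 ht.2
  have h2 := h.null_coords_le ht.1 ht.2 le_rfl
  rw [h.source] at h1
  rw [h.target] at h2
  simp only [add_zero, sub_zero] at h1
  exact ⟨⟨h1.1, h2.1⟩, ⟨h1.2, h2.2⟩⟩

/-- Along a causal curve from the origin the functions `(x + y) * (x - y) ± 4 * z` are
nondecreasing. -/
theorem IsCurve.four_mul_abs_le (hT : 0 ≤ T)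
    (h : IsCurve FutureNonspacelike T γ (0, 0, 0) (x, y, z)) : 4 * |z| ≤ x ^ 2 - y ^ 2 := by
  have hA := absolutelyContinuous_of_exists_lipschitz hT h.exists_lipschitz_add
  have hB := absolutelyContinuous_of_exists_lipschitz hT h.exists_lipschitz_sub
  have hZ := absolutelyContinuous_of_exists_lipschitz hT h.exists_lipschitz_snd_snd
  have h1 := le_of_ae_hasDerivAt_nonneg hT ((hA.fun_mul hB).fun_sub (hZ.const_mul 4))
    (h.ae_exists_null.mono (by
      rintro t ⟨ht, u, v, hu, hv, hA, hB, hZ, -⟩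
      refine ⟨_, (hA.mul hB).sub (hZ.const_mul 4), ?_⟩
      have := mul_nonneg (h.null_coords_mem ht).1.1 hv
      linarith))
  have h2 := le_of_ae_hasDerivAt_nonneg hT ((hA.fun_mul hB).fun_add (hZ.const_mul 4))
    (h.ae_exists_null.mono (by
      rintro t ⟨ht, u, v, hu, hv, hA, hB, hZ, -⟩
      refine ⟨_, (hA.mul hB).add (hZ.const_mul 4), ?_⟩
      have := mul_nonneg (h.null_coords_mem ht).2.1 hu
      linarith))
  rw [h.source, h.target] at h1 h2
  simp only [add_zero, sub_zero, mul_zero] at h1 h2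
  have : |z| ≤ (x ^ 2 - y ^ 2) / 4 := abs_le.2 ⟨by linarith, by linarith⟩
  linarith

theorem sqrt_mul_le_half {u v r : ℝ} (hu : 0 ≤ u) (hv : 0 ≤ v) (hr : 0 < r) :
    √(u * v) ≤ (r * u + v / r) / 2 := by
  have h0 : 0 ≤ v / r := div_nonneg hv hr.le
  have h1 : u * v = (r * u) * (v / r) := by field_simp
  rw [h1]
  refine Real.sqrt_le_iff.2 ⟨by positivity, ?_⟩
  nlinarith [sq_nonneg (r * u - v / r)]

/-- The calibration with a constant multiplier. -/
theorem IsCurve.length_le_of_pos (hT : 0 ≤ T)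
    (h : IsCurve FutureNonspacelike T γ (0, 0, 0) (x, y, z)) {r : ℝ} (hr : 0 < r) :
    length T γ ≤ (r * (x + y) + (x - y) / r) / 2 := by
  have hA := absolutelyContinuous_of_exists_lipschitz hT h.exists_lipschitz_add
  have hB := absolutelyContinuous_of_exists_lipschitz hT h.exists_lipschitz_sub
  have h1 := integral_le_sub_of_ae_hasDerivAt (f := fun t ↦ √|g (deriv γ t) (deriv γ t)|) hT
    ((hA.const_mul (r / 2)).fun_add (hB.const_mul (1 / (2 * r))))
    (h.ae_exists_null.mono (by
      rintro t ⟨ht, u, v, hu, hv, hA, hB, -, hg⟩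
      refine ⟨Real.sqrt_nonneg _, _, (hA.const_mul _).add (hB.const_mul _), ?_⟩
      rw [hg, abs_neg, abs_of_nonneg (mul_nonneg hu hv)]
      refine (sqrt_mul_le_half hu hv hr).trans (le_of_eq ?_)
      field_simp))
  rw [h.source, h.target] at h1
  refine h1.trans (le_of_eq ?_)
  field_simp
  ring

/-- The calibration with the multiplier `α - β * (x - y)`, which depends on the point of the curve.
It is affine in `x - y`, so that its product with `d(x + y)` is exact up to a multiple of the
contact form, while its inverse times `d(x - y)` has a logarithmic primitive. -/
theorem IsCurve.length_le_of_affine (hT : 0 ≤ T)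
    (h : IsCurve FutureNonspacelike T γ (0, 0, 0) (x, y, z)) {α β : ℝ} (hα : 0 < α) (hβ : β ≠ 0)
    (hpos : 0 < α - β * (x - y)) :
    length T γ ≤ (α * (x + y) - β * ((x ^ 2 - y ^ 2) / 2 + 2 * z) +
      (Real.log α - Real.log (α - β * (x - y))) / β) / 2 := by
  -- An affine function is bounded below by the smaller of its values at the end points.
  obtain ⟨m, M, hm, hmM⟩ : ∃ m M : ℝ, 0 < m ∧
      ∀ t ∈ Icc 0 T, α - β * ((γ t).1 - (γ t).2.1) ∈ Icc m M := by
    refine ⟨min α (α - β * (x - y)), max α (α - β * (x - y)), lt_min hα hpos, fun t ht ↦ ?_⟩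
    obtain ⟨h1, h2⟩ := (h.null_coords_mem ht).2
    rcases le_total 0 β with hb | hb
    · exact ⟨(min_le_right _ _).trans (by nlinarith), le_max_of_le_left (by nlinarith)⟩
    · exact ⟨(min_le_left _ _).trans (by nlinarith), le_max_of_le_right (by nlinarith)⟩
  have hA := absolutelyContinuous_of_exists_lipschitz hT h.exists_lipschitz_add
  have hB := absolutelyContinuous_of_exists_lipschitz hT h.exists_lipschitz_sub
  have hZ := absolutelyContinuous_of_exists_lipschitz hT h.exists_lipschitz_snd_snd
  have hL : AbsolutelyContinuousOnInterval
      (fun t ↦ Real.log (α - β * ((γ t).1 - (γ t).2.1))) 0 T := by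
    have hcd : ContDiffOn ℝ 1 Real.log (Icc m M) := fun s hs ↦
      (Real.contDiffAt_log.2 (hm.trans_le hs.1).ne').contDiffWithinAt
    obtain ⟨L₁, hL₁⟩ := hcd.exists_lipschitzOnWith one_ne_zero (convex_Icc m M) isCompact_Icc
    obtain ⟨L₂, hL₂⟩ := h.exists_lipschitz_comp (φ := fun q ↦ α - β * (q.1 - q.2.1))
      ((LipschitzWith.const α).sub ((lipschitzWith_smul β).comp
        (LipschitzWith.prod_fst.sub (LipschitzWith.prod_fst.comp LipschitzWith.prod_snd))))
    exact absolutelyContinuous_of_exists_lipschitz hT ⟨_, hL₁.comp hL₂ hmM⟩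
  have h1 := integral_le_sub_of_ae_hasDerivAt (f := fun t ↦ √|g (deriv γ t) (deriv γ t)|) hT
    (((hA.const_mul (α / 2)).fun_sub
      (((hA.fun_mul hB).const_mul (β / 4)).fun_add (hZ.const_mul β))).fun_sub
      (hL.const_mul (1 / (2 * β))))
    (h.ae_exists_null.mono (by
      rintro t ⟨ht, u, v, hu, hv, hA, hB, hZ, hg⟩
      have hr : 0 < α - β * ((γ t).1 - (γ t).2.1) := hm.trans_le (hmM t ht).1
      refine ⟨Real.sqrt_nonneg _, _, ((hA.const_mul _).sub
        (((hA.mul hB).const_mul _).add (hZ.const_mul _))).sub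
        ((((hB.const_mul β).const_sub α).log hr.ne').const_mul _), ?_⟩
      rw [hg, abs_neg, abs_of_nonneg (mul_nonneg hu hv)]
      refine (sqrt_mul_le_half hu hv hr).trans (le_of_eq ?_)
      field_simp
      ring))
  rw [h.source, h.target] at h1
  simp only [add_zero, sub_zero, mul_zero] at h1
  refine h1.trans (le_of_eq ?_)
  field_simp
  ring

/-- The bound of `IsCurve.length_le_of_affine` with the constants read off from the extremal of
parameter `p` that ends over `(x, y)`. -/
theorem IsCurve.length_le_of_ne_zero (hT : 0 ≤ T)
    (h : IsCurve FutureNonspacelike T γ (0, 0, 0) (x, y, z)) (hD : 0 < x ^ 2 - y ^ 2) {p : ℝ}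
    (hp : p ≠ 0) :
    length T γ ≤ √(x ^ 2 - y ^ 2) / 2 *
      (Real.cosh p - 4 * (z / (x ^ 2 - y ^ 2)) * Real.sinh p + p / Real.sinh p) := by
  have hT' : T ∈ Icc 0 T := ⟨hT, le_rfl⟩
  have hb := (h.null_coords_mem hT').2
  have ha := (h.null_coords_mem hT').1
  rw [h.target] at ha hb
  have ha0 : 0 ≤ x + y := ha.1
  have hb0 : 0 ≤ x - y := hb.1
  have hab : x ^ 2 - y ^ 2 = (x + y) * (x - y) := by ring
  have hb1 : 0 < x - y := by
    rcases hb0.eq_or_lt with h0 | h0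
    · rw [hab, ← h0, mul_zero] at hD
      exact absurd hD (lt_irrefl _)
    · exact h0
  set S := √(x ^ 2 - y ^ 2) with hS
  have hS0 : 0 < S := Real.sqrt_pos.2 hD
  have hSS : S ^ 2 = x ^ 2 - y ^ 2 := Real.sq_sqrt hD.le
  have hs : Real.sinh p ≠ 0 := by rwa [Ne, Real.sinh_eq_zero]
  have he : 0 < Real.exp p := Real.exp_pos p
  have hsc : Real.exp p = Real.cosh p + Real.sinh p := (Real.cosh_add_sinh p).symm
  have hsc' : Real.exp (-p) = Real.cosh p - Real.sinh p := (Real.cosh_sub_sinh p).symm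
  have key := h.length_le_of_affine hT (α := (x - y) / S * Real.exp p)
    (β := 2 * Real.sinh p / S) (by positivity) (by positivity)
  have hend : (x - y) / S * Real.exp p - 2 * Real.sinh p / S * (x - y) =
      (x - y) / S * Real.exp (-p) := by
    rw [hsc, hsc']
    ring
  rw [hend, Real.log_mul (by positivity) (by positivity), Real.log_mul (by positivity)
    (by positivity), Real.log_exp, Real.log_exp] at key
  refine (key (by positivity)).trans (le_of_eq ?_)
  rw [hsc, ← hSS]
  have h1 : (x - y) / S * (Real.cosh p + Real.sinh p) * (x + y) =
      S * (Real.cosh p + Real.sinh p) := by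
    have : (x - y) * (x + y) = S ^ 2 := by rw [hSS]; ring
    field_simp
    linear_combination this
  rw [h1]
  field_simp
  ring

end Upper

/-! ### The maximizing curves -/

/-- A smooth curve given by its null coordinates `A = x + y`, `B = x - y`, with derivatives
`u, v > 0` of constant product, and by the vertical coordinate which makes it horizontal. -/
theorem exists_isCurve_of_null {A B Z u v : ℝ → ℝ} {l : ℝ} (hA : ContDiff ℝ 1 A)
    (hB : ContDiff ℝ 1 B) (hZ : ContDiff ℝ 1 Z) (hl : 0 ≤ l) (hu : ∀ t, 0 < u t)
    (hv : ∀ t, 0 < v t) (huv : ∀ t, u t * v t = l ^ 2) (hA' : ∀ t, HasDerivAt A (u t) t)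
    (hB' : ∀ t, HasDerivAt B (v t) t)
    (hZ' : ∀ t, HasDerivAt Z ((B t * u t - A t * v t) / 4) t)
    (hA0 : A 0 = 0) (hB0 : B 0 = 0) (hZ0 : Z 0 = 0) :
    ∃ γ, IsCurve FutureTimelike 1 γ (0, 0, 0) ((A 1 + B 1) / 2, (A 1 - B 1) / 2, Z 1) ∧
      length 1 γ = l := by
  have hd : ∀ t, HasDerivAt (fun t ↦ ((A t + B t) / 2, (A t - B t) / 2, Z t))
      ((u t + v t) / 2, (u t - v t) / 2, (B t * u t - A t * v t) / 4) t := fun t ↦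
    (((hA' t).add (hB' t)).div_const 2).prodMk
      ((((hA' t).sub (hB' t)).div_const 2).prodMk (hZ' t))
  refine ⟨_, ⟨?_, ae_of_all _ fun t ↦ ⟨(hd t).differentiableAt, ?_⟩, ?_, rfl⟩, ?_⟩
  · have hc : ContDiff ℝ 1 (fun t ↦ ((A t + B t) / 2, (A t - B t) / 2, Z t)) :=
      ((hA.add hB).div_const 2).prodMk (((hA.sub hB).div_const 2).prodMk hZ)
    exact hc.contDiffOn.exists_lipschitzOnWith one_ne_zero (convex_Icc 0 1) isCompact_Icc
  · rw [(hd t).deriv, futureTimelike_iff]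
    refine ⟨(u t + v t) / 2, (u t - v t) / 2, ?_, ?_⟩
    · rw [abs_lt]
      constructor <;> linarith [hu t, hv t]
    · simp only [X₁, X₂, Prod.smul_mk, Prod.mk_add_mk, smul_eq_mul, Prod.mk.injEq]
      refine ⟨by ring, by ring, by ring⟩
  · simp [hA0, hB0, hZ0]
  · rw [length]
    have : ∀ t, √|g (deriv (fun t ↦ ((A t + B t) / 2, (A t - B t) / 2, Z t)) t)
        (deriv (fun t ↦ ((A t + B t) / 2, (A t - B t) / 2, Z t)) t)| = l := fun t ↦ by
      have h1 : g ((u t + v t) / 2, (u t - v t) / 2, (B t * u t - A t * v t) / 4)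
          ((u t + v t) / 2, (u t - v t) / 2, (B t * u t - A t * v t) / 4) = -l ^ 2 := by
        rw [← huv t, g]
        ring
      rw [(hd t).deriv, h1, abs_neg, abs_of_nonneg (sq_nonneg l), Real.sqrt_sq hl]
    simp [this]

/-- For every `p` there is a timelike curve over `(x, y)`, a branch of hyperbola (a segment if
`p = 0`), whose height is `alpha p` in units of `x ^ 2 - y ^ 2`. -/
theorem exists_isCurve_alpha {x y : ℝ} (ha : 0 < x + y) (hb : 0 < x - y) (p : ℝ) :
    ∃ γ, IsCurve FutureTimelike 1 γ (0, 0, 0) (x, y, (x ^ 2 - y ^ 2) * alpha p) ∧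
      length 1 γ = √(x ^ 2 - y ^ 2) * divSinh p := by
  have hD : x ^ 2 - y ^ 2 = (x + y) * (x - y) := by ring
  have hD0 : 0 < x ^ 2 - y ^ 2 := by rw [hD]; positivity
  have hSS : √(x ^ 2 - y ^ 2) ^ 2 = x ^ 2 - y ^ 2 := Real.sq_sqrt hD0.le
  have hlin (c t : ℝ) : HasDerivAt (fun s : ℝ ↦ c * s) c t := by
    simpa using (hasDerivAt_id t).const_mul c
  rcases eq_or_ne p 0 with rfl | hp
  · obtain ⟨γ, h1, h2⟩ := exists_isCurve_of_null (A := fun t ↦ (x + y) * t)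
      (B := fun t ↦ (x - y) * t) (Z := fun _ ↦ 0) (u := fun _ ↦ x + y) (v := fun _ ↦ x - y)
      (l := √(x ^ 2 - y ^ 2)) (by fun_prop) (by fun_prop) (by fun_prop) (Real.sqrt_nonneg _)
      (fun _ ↦ ha) (fun _ ↦ hb) (fun _ ↦ by rw [hSS, hD]) (hlin _) (hlin _)
      (fun t ↦ (hasDerivAt_const t (0 : ℝ)).congr_deriv (by ring)) (by simp) (by simp) rfl
    refine ⟨γ, ?_, by simpa [divSinh] using h2⟩
    convert h1 using 2
    · ring
    · rw [alpha_zero]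
      ext <;> ring
  · have hs : Real.sinh p ≠ 0 := by rwa [Ne, Real.sinh_eq_zero]
    have hps : 0 < p / Real.sinh p := by
      rcases hp.lt_or_gt with h | h
      · exact div_pos_of_neg_of_neg h (Real.sinh_neg_iff.2 h)
      · exact div_pos h (Real.sinh_pos_iff.2 h)
    have hee : Real.exp p * Real.exp (-p) = 1 := by rw [← Real.exp_add]; simp
    have hse : 2 * Real.sinh p = Real.exp p - Real.exp (-p) := by rw [Real.sinh_eq]; ring
    -- `a` and `b` are the null velocities at the midpoint `t = 1 / 2`.
    set a := (x + y) * (p / Real.sinh p) with ha_def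
    set b := (x - y) * (p / Real.sinh p) with hb_def
    have ha0 : 0 < a := by positivity
    have hb0 : 0 < b := by positivity
    have hE (r t : ℝ) : HasDerivAt (fun s : ℝ ↦ Real.exp (2 * p * s + r))
        (2 * p * Real.exp (2 * p * t + r)) t :=
      ((hlin (2 * p) t).add_const r).exp.congr_deriv (by ring)
    have hE' (r t : ℝ) : HasDerivAt (fun s : ℝ ↦ Real.exp (-(2 * p) * s + r))
        (-(2 * p) * Real.exp (-(2 * p) * t + r)) t :=
      ((hlin (-(2 * p)) t).add_const r).exp.congr_deriv (by ring)
    obtain ⟨γ, h1, h2⟩ := exists_isCurve_of_null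
      (A := fun t ↦ a / (2 * p) * (Real.exp (2 * p * t + -p) - Real.exp (-p)))
      (B := fun t ↦ b / (2 * p) * (Real.exp p - Real.exp (-(2 * p) * t + p)))
      (Z := fun t ↦ a * b / (8 * p ^ 2) * (Real.sinh (2 * p * t) - 2 * p * t))
      (u := fun t ↦ a * Real.exp (2 * p * t + -p)) (v := fun t ↦ b * Real.exp (-(2 * p) * t + p))
      (l := √(x ^ 2 - y ^ 2) * (p / Real.sinh p)) (by fun_prop) (by fun_prop) (by fun_prop)
      (by positivity) (fun _ ↦ by positivity) (fun _ ↦ by positivity)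
      (fun t ↦ by
        have : Real.exp (2 * p * t + -p) * Real.exp (-(2 * p) * t + p) = 1 := by
          rw [← Real.exp_add, ← Real.exp_zero]
          congr 1
          ring
        rw [mul_pow, hSS, hD]
        linear_combination a * b * this)
      (fun t ↦ (((hE (-p) t).sub_const _).const_mul _).congr_deriv (by field_simp))
      (fun t ↦ (((hE' p t).const_sub _).const_mul _).congr_deriv (by field_simp))
      (fun t ↦ (((hlin (2 * p) t).sinh.sub (hlin (2 * p) t)).const_mul _).congr_deriv (by
        have hx : Real.exp (2 * p * t) * Real.exp (-(2 * p) * t) = 1 := by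
          rw [← Real.exp_add, ← Real.exp_zero]
          congr 1
          ring
        rw [Real.cosh_eq, Real.exp_add, Real.exp_add, ← neg_mul]
        generalize Real.exp (2 * p * t) = e at hx ⊢
        generalize Real.exp (-(2 * p) * t) = f at hx ⊢
        field_simp
        linear_combination (16 * e * f - 8 * e - 8 * f) * hee + 16 * hx))
      (by simp) (by simp) (by simp)
    refine ⟨γ, ?_, ?_⟩
    · have hA1 : a / (2 * p) * (Real.exp (2 * p * 1 + -p) - Real.exp (-p)) = x + y := by
        rw [show 2 * p * 1 + -p = p by ring, ← hse, ha_def]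
        field_simp
      have hB1 : b / (2 * p) * (Real.exp p - Real.exp (-(2 * p) * 1 + p)) = x - y := by
        rw [show -(2 * p) * 1 + p = -p by ring, ← hse, hb_def]
        field_simp
      have hZ1 : a * b / (8 * p ^ 2) * (Real.sinh (2 * p * 1) - 2 * p * 1) =
          (x ^ 2 - y ^ 2) * alpha p := by
        rw [alpha, ha_def, hb_def, hD]
        field_simp
      simp only [hA1, hB1, hZ1] at h1
      convert h1 using 2
      · ring
      · ext <;> ring
    · rw [h2, divSinh, if_neg (by simp), if_neg (by exact_mod_cast hp), EReal.toReal_coe]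

/-! ### Length and distance -/

theorem IsCurve.le_slDist {T : ℝ} {γ : ℝ → Heis} {a b : Heis} (hT : 0 ≤ T)
    (h : IsCurve FutureNonspacelike T γ a b) : (length T γ : EReal) ≤ slDist a b :=
  le_sSup ⟨T, hT, γ, h, rfl⟩

theorem slDist_le {a b : Heis} {r : ℝ}
    (h : ∀ T γ, 0 ≤ T → IsCurve FutureNonspacelike T γ a b → length T γ ≤ r) :
    slDist a b ≤ (r : EReal) := by
  refine sSup_le ?_
  rintro _ ⟨T, hT, γ, hγ, rfl⟩
  exact_mod_cast h T γ hT hγ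

theorem length_nonneg {T : ℝ} (hT : 0 ≤ T) (γ : ℝ → Heis) : 0 ≤ length T γ :=
  intervalIntegral.integral_nonneg hT fun _ _ ↦ Real.sqrt_nonneg _

theorem slDist_nonneg {a b : Heis} (h : b ∈ causalFuture a) : 0 ≤ slDist a b := by
  obtain ⟨T, hT, γ, hγ⟩ := h
  exact le_trans (by exact_mod_cast length_nonneg hT γ) (hγ.le_slDist hT)

/-- Timelike curves have positive length. The integrand is dominated by the derivative of `x`, hence
integrable, so its integral is not a junk value. -/
theorem IsCurve.length_pos {T : ℝ} {γ : ℝ → Heis} {a b : Heis} (hT : 0 < T)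
    (h : IsCurve FutureTimelike T γ a b) : 0 < length T γ := by
  have hA := absolutelyContinuous_of_exists_lipschitz hT.le h.exists_lipschitz_add
  have hB := absolutelyContinuous_of_exists_lipschitz hT.le h.exists_lipschitz_sub
  have hint : IntervalIntegrable (fun t ↦ √|g (deriv γ t) (deriv γ t)|) volume 0 T := by
    refine ((hA.fun_add hB).const_mul (1 / 2)).intervalIntegrable_deriv.mono_fun ?_ ?_
    · have hm := measurable_deriv γ
      have : Measurable fun t ↦ √|g (deriv γ t) (deriv γ t)| := by
        unfold g
        fun_prop
      exact this.aestronglyMeasurable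
    · rw [uIoc_of_le hT.le]
      refine ae_restrict_of_ae_restrict_of_subset Ioc_subset_Icc_self
        (h.of_timelike.ae_exists_null.mono ?_)
      rintro t ⟨-, u, v, hu, hv, hA, hB, -, hg⟩
      have hd := ((hA.add hB).const_mul (1 / 2)).deriv
      simp only [Pi.add_apply] at hd
      beta_reduce
      rw [hd, hg, abs_neg, abs_of_nonneg (mul_nonneg hu hv), Real.norm_of_nonneg (by positivity),
        Real.norm_of_nonneg (by positivity)]
      exact (sqrt_mul_le_half hu hv one_pos).trans (le_of_eq (by ring))
  refine (intervalIntegral.integral_pos_iff_support_of_nonneg_ae'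
    (ae_of_all _ fun t ↦ Real.sqrt_nonneg _) hint).2 ⟨hT, ?_⟩
  have hsub : ∀ᵐ t ∂volume.restrict (Ioc 0 T),
      t ∈ Function.support fun t ↦ √|g (deriv γ t) (deriv γ t)| := by
    refine ae_restrict_of_ae_restrict_of_subset Ioc_subset_Icc_self (h.velocity.mono fun t ht ↦ ?_)
    exact (Real.sqrt_pos.2 (abs_pos.2 ht.2.2.1.ne)).ne'
  have hle : volume (Ioc 0 T) ≤
      volume ((Function.support fun t ↦ √|g (deriv γ t) (deriv γ t)|) ∩ Ioc 0 T) := by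
    refine measure_mono_ae ?_
    filter_upwards [(ae_restrict_iff' measurableSet_Ioc).1 hsub] with t ht hmem
    exact ⟨ht hmem, hmem⟩
  refine lt_of_lt_of_le ?_ hle
  simpa using hT

/-- On the light cone `x ^ 2 = y ^ 2` all causal curves from the origin have length `0`. -/
theorem IsCurve.length_le_zero_of_null {T x y z : ℝ} {γ : ℝ → Heis} (hT : 0 ≤ T)
    (h : IsCurve FutureNonspacelike T γ (0, 0, 0) (x, y, z)) (hD : x ^ 2 - y ^ 2 = 0) :
    length T γ ≤ 0 := by
  have hmem := h.null_coords_mem ⟨hT, le_rfl⟩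
  rw [h.target] at hmem
  have hprod : (x + y) * (x - y) = 0 := by linarith
  refine le_of_forall_pos_le_add fun ε hε ↦ ?_
  -- One null coordinate vanishes; a large or small multiplier makes the other one negligible.
  rcases mul_eq_zero.1 hprod with h0 | h0
  · have hb : 0 ≤ x - y := hmem.2.1
    have h1 := h.length_le_of_pos hT (r := (x - y + 1) / ε) (by positivity)
    rw [h0] at h1
    have : (x - y) / ((x - y + 1) / ε) ≤ ε := by
      rw [div_le_iff₀ (by positivity)]
      field_simp
      linarith
    linarith
  · have ha : 0 ≤ x + y := hmem.1.1
    have h1 := h.length_le_of_pos hT (r := ε / (x + y + 1)) (by positivity)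
    rw [h0] at h1
    have : ε / (x + y + 1) * (x + y) ≤ ε := by
      rw [div_mul_eq_mul_div, div_le_iff₀ (by positivity)]
      nlinarith
    simp only [zero_div, add_zero] at h1
    linarith

theorem tendsto_div_sinh_atTop :
    Filter.Tendsto (fun p : ℝ ↦ p / Real.sinh p) Filter.atTop (nhds 0) := by
  have h : Filter.Tendsto (fun p : ℝ ↦ 2 / p) Filter.atTop (nhds 0) :=
    Filter.Tendsto.const_div_atTop Filter.tendsto_id 2
  refine squeeze_zero' ?_ ?_ h
  · filter_upwards [Filter.eventually_gt_atTop 0] with p hp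
    exact div_nonneg hp.le (Real.sinh_nonneg_iff.2 hp.le)
  · filter_upwards [Filter.eventually_gt_atTop 0] with p hp
    have h1 : p / 2 < Real.sinh (p / 2) := Real.self_lt_sinh_iff.2 (by linarith)
    have h2 : Real.sinh (p / 2) < Real.cosh (p / 2) := Real.sinh_lt_cosh _
    have h3 : Real.sinh p = 2 * Real.sinh (p / 2) * Real.cosh (p / 2) := by
      rw [← Real.sinh_two_mul]
      congr 1
      ring
    have h4 : p * p ≤ 2 * Real.sinh p := by rw [h3]; nlinarith
    rw [div_le_div_iff₀ (Real.sinh_pos_iff.2 hp) hp]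
    exact h4

/-- Where `4 * |z| = x ^ 2 - y ^ 2`, all causal curves from the origin have length `0`: let `p` tend
to `±∞` in `IsCurve.length_le_of_ne_zero`. -/
theorem IsCurve.length_le_zero_of_boundary {T x y z : ℝ} {γ : ℝ → Heis} (hT : 0 ≤ T)
    (h : IsCurve FutureNonspacelike T γ (0, 0, 0) (x, y, z)) (hD : 0 < x ^ 2 - y ^ 2)
    (hz : 4 * |z / (x ^ 2 - y ^ 2)| = 1) : length T γ ≤ 0 := by
  have hlim : Filter.Tendsto (fun p : ℝ ↦ √(x ^ 2 - y ^ 2) / 2 *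
      (Real.exp (-p) + p / Real.sinh p)) Filter.atTop (nhds (√(x ^ 2 - y ^ 2) / 2 * (0 + 0))) :=
    (Real.tendsto_exp_neg_atTop_nhds_zero.add tendsto_div_sinh_atTop).const_mul _
  rw [add_zero, mul_zero] at hlim
  refine ge_of_tendsto hlim ?_
  filter_upwards [Filter.eventually_gt_atTop 0] with p hp
  rw [← Real.cosh_sub_sinh]
  rcases abs_choice (z / (x ^ 2 - y ^ 2)) with hs | hs <;> rw [hs] at hz
  · refine (h.length_le_of_ne_zero hT hD hp.ne').trans (le_of_eq ?_)
    rw [hz, one_mul]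
  · refine (h.length_le_of_ne_zero hT hD (neg_ne_zero.2 hp.ne')).trans (le_of_eq ?_)
    rw [Real.cosh_neg, Real.sinh_neg, neg_div_neg_eq,
      show 4 * (z / (x ^ 2 - y ^ 2)) = -1 by linarith, neg_mul_neg, one_mul]

/-- The upper bound by the length of the curve of `exists_isCurve_alpha`. -/
theorem IsCurve.length_le_divSinh {T x y z : ℝ} {γ : ℝ → Heis} (hT : 0 ≤ T)
    (h : IsCurve FutureNonspacelike T γ (0, 0, 0) (x, y, z)) (hD : 0 < x ^ 2 - y ^ 2) {p : ℝ}
    (hz : z / (x ^ 2 - y ^ 2) = alpha p) : length T γ ≤ √(x ^ 2 - y ^ 2) * divSinh p := by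
  rcases eq_or_ne p 0 with rfl | hp
  · have hmem := h.null_coords_mem ⟨hT, le_rfl⟩
    rw [h.target] at hmem
    have ha0 : 0 ≤ x + y := hmem.1.1
    have hab : x ^ 2 - y ^ 2 = (x + y) * (x - y) := by ring
    have ha : 0 < x + y := ha0.lt_of_ne' fun h0 ↦ by simp [hab, h0] at hD
    have hS : 0 < √(x ^ 2 - y ^ 2) := Real.sqrt_pos.2 hD
    have hSS : √(x ^ 2 - y ^ 2) ^ 2 = (x + y) * (x - y) := by rw [Real.sq_sqrt hD.le, hab]
    refine (h.length_le_of_pos hT (r := √(x ^ 2 - y ^ 2) / (x + y)) (by positivity)).trans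
      (le_of_eq ?_)
    simp only [divSinh, EReal.coe_zero, EReal.zero_ne_top, EReal.zero_ne_bot, or_self, if_false,
      if_true, mul_one]
    field_simp
    linear_combination -hSS
  · have hs : Real.sinh p ≠ 0 := by rwa [Ne, Real.sinh_eq_zero]
    refine (h.length_le_of_ne_zero hT hD hp).trans (le_of_eq ?_)
    rw [hz, divSinh, if_neg (by simp), if_neg (by exact_mod_cast hp), EReal.toReal_coe, alpha,
      Real.sinh_two_mul]
    field_simp
    ring

theorem divSinh_coe_pos (p : ℝ) : 0 < divSinh p := by
  rcases eq_or_ne p 0 with rfl | hp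
  · simp [divSinh]
  · rw [divSinh, if_neg (by simp), if_neg (by exact_mod_cast hp), EReal.toReal_coe]
    rcases hp.lt_or_gt with h | h
    · exact div_pos_of_neg_of_neg h (Real.sinh_neg_iff.2 h)
    · exact div_pos h (Real.sinh_pos_iff.2 h)

theorem divSinh_coe_eq_one {p : ℝ} : divSinh p = 1 ↔ p = 0 := by
  refine ⟨fun h ↦ ?_, fun h ↦ by simp [divSinh, h]⟩
  by_contra hp
  rw [divSinh, if_neg (by simp), if_neg (by exact_mod_cast hp), EReal.toReal_coe,
    div_eq_one_iff_eq (by rwa [Ne, Real.sinh_eq_zero])] at h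
  rcases lt_or_gt_of_ne hp with h0 | h0
  · exact (Real.sinh_lt_self_iff.2 h0).ne' h
  · exact (Real.self_lt_sinh_iff.2 h0).ne h

/-- In the interior `4 * |z| < x ^ 2 - y ^ 2` of the causal future the supremum is attained, by a
timelike curve. -/
theorem slDist_eq_of_interior {x y z p : ℝ} (hJ : (x, y, z) ∈ causalFuture (0, 0, 0))
    (hD : 0 < x ^ 2 - y ^ 2) (hz : z / (x ^ 2 - y ^ 2) = alpha p) :
    (x, y, z) ∈ chronologicalFuture (0, 0, 0) ∧
      slDist (0, 0, 0) (x, y, z) = ((√(x ^ 2 - y ^ 2) * divSinh p : ℝ) : EReal) := by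
  obtain ⟨T, hT, γ₀, hγ₀⟩ := hJ
  have hmem := hγ₀.null_coords_mem ⟨hT, le_rfl⟩
  rw [hγ₀.target] at hmem
  have ha0 : 0 ≤ x + y := hmem.1.1
  have hb0 : 0 ≤ x - y := hmem.2.1
  have hab : x ^ 2 - y ^ 2 = (x + y) * (x - y) := by ring
  obtain ⟨γ, hγ, hl⟩ := exists_isCurve_alpha (ha0.lt_of_ne' fun h0 ↦ by simp [hab, h0] at hD)
    (hb0.lt_of_ne' fun h0 ↦ by simp [hab, h0] at hD) p
  rw [← hz, mul_div_cancel₀ _ hD.ne'] at hγ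
  refine ⟨⟨1, one_pos, γ, hγ⟩, le_antisymm ?_ ?_⟩
  · exact slDist_le fun T γ hT h ↦ h.length_le_divSinh hT hD hz
  · rw [← hl]
    exact hγ.of_timelike.le_slDist zero_le_one

theorem slDist_pos_of_mem_chronologicalFuture {a b : Heis} (h : b ∈ chronologicalFuture a) :
    0 < slDist a b := by
  obtain ⟨T, hT, γ, hγ⟩ := h
  refine lt_of_lt_of_le ?_ (hγ.of_timelike.le_slDist hT.le)
  exact_mod_cast hγ.length_pos hT

end HeisSL

open HeisSL in
theorem mainTheorem1 :
    Set.BijOn HeisSL.alpha Set.univ (Set.Ioo (-(1 / 4)) (1 / 4)) ∧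
    ∀ x y z : ℝ, (x, y, z) ∈ HeisSL.causalFuture (0, 0, 0) →
      4 * |z| ≤ x ^ 2 - y ^ 2 ∧
      HeisSL.slDist (0, 0, 0) (x, y, z) =
        ((Real.sqrt (x ^ 2 - y ^ 2) *
          HeisSL.divSinh (HeisSL.betaExt (z / (x ^ 2 - y ^ 2))) : ℝ) : EReal) ∧
      (z = 0 ↔
        HeisSL.slDist (0, 0, 0) (x, y, z) = ((Real.sqrt (x ^ 2 - y ^ 2) : ℝ) : EReal)) ∧
      ((x, y, z) ∈ HeisSL.causalFuture (0, 0, 0) \ HeisSL.chronologicalFuture (0, 0, 0) ↔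
        HeisSL.slDist (0, 0, 0) (x, y, z) = 0) := by
  refine ⟨bijOn_alpha, fun x y z hJ ↦ ?_⟩
  have hle : 4 * |z| ≤ x ^ 2 - y ^ 2 := by
    obtain ⟨T, hT, γ, hγ⟩ := hJ
    exact hγ.four_mul_abs_le hT
  have hnot : slDist (0, 0, 0) (x, y, z) = 0 → (x, y, z) ∉ chronologicalFuture (0, 0, 0) :=
    fun h0 hI ↦ (slDist_pos_of_mem_chronologicalFuture hI).ne' h0
  refine ⟨hle, ?_⟩
  have hD0 : 0 ≤ x ^ 2 - y ^ 2 := by linarith [abs_nonneg z]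
  rcases hD0.eq_or_lt with hD | hD
  · have hz : z = 0 := by
      rw [← hD] at hle
      exact abs_nonpos_iff.1 (by linarith)
    have hd : slDist (0, 0, 0) (x, y, z) = 0 := le_antisymm
      (slDist_le fun T γ hT h ↦ h.length_le_zero_of_null hT hD.symm) (slDist_nonneg hJ)
    simp only [← hD, Real.sqrt_zero, zero_mul, EReal.coe_zero]
    exact ⟨hd, iff_of_true hz hd, iff_of_true ⟨hJ, hnot hd⟩ hd⟩
  have hS : 0 < √(x ^ 2 - y ^ 2) := Real.sqrt_pos.2 hD
  have hs : 4 * |z / (x ^ 2 - y ^ 2)| ≤ 1 := by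
    rw [abs_div, abs_of_pos hD, mul_div_assoc', div_le_one hD]
    exact hle
  rcases hs.eq_or_lt with hs | hs
  · have hd : slDist (0, 0, 0) (x, y, z) = 0 := le_antisymm
      (slDist_le fun T γ hT h ↦ h.length_le_zero_of_boundary hT hD hs) (slDist_nonneg hJ)
    have hz : z ≠ 0 := by
      rintro rfl
      simp at hs
    have hβ : divSinh (betaExt (z / (x ^ 2 - y ^ 2))) = 0 := by
      rw [betaExt]
      rcases abs_choice (z / (x ^ 2 - y ^ 2)) with h | h <;> rw [h] at hs
      · rw [if_pos (by linarith), divSinh, if_pos (Or.inl rfl)]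
      · rw [if_neg (by linarith), if_pos (by linarith), divSinh, if_pos (Or.inr rfl)]
    rw [hd, hβ, mul_zero, EReal.coe_zero]
    refine ⟨rfl, iff_of_false hz ?_, iff_of_true ⟨hJ, hnot hd⟩ rfl⟩
    exact_mod_cast hS.ne
  · obtain ⟨h1, h2⟩ := abs_lt.1 (by linarith : |z / (x ^ 2 - y ^ 2)| < 1 / 4)
    have hα := alpha_beta ⟨h1, h2⟩
    have hβ : betaExt (z / (x ^ 2 - y ^ 2)) = (beta (z / (x ^ 2 - y ^ 2)) : EReal) := by
      rw [betaExt, if_neg h2.not_ge, if_neg h1.not_ge]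
    obtain ⟨hI, hd⟩ := slDist_eq_of_interior hJ hD hα.symm
    rw [hβ, hd]
    refine ⟨rfl, ?_, iff_of_false (fun h ↦ h.2 hI) ?_⟩
    · rw [EReal.coe_eq_coe_iff, mul_eq_left₀ hS.ne', divSinh_coe_eq_one,
        ← alpha_injective.eq_iff (a := beta _), hα, alpha_zero, div_eq_zero_iff, or_iff_left hD.ne']
    · exact_mod_cast (mul_pos hS (divSinh_coe_pos _)).ne'
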